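/- Let $G$ be a connected noncompact simple real Lie group whose Lie algebra $\mathfrak g$ has a compact Cartan subalgebra, and such that the associated symmetric space $G/K$ of noncompact type is not Hermitian. Thus: $\mathfrak g$ is a finite-dimensional simple real Lie algebra whose Killing form $\kappa$ is not negative definite; $\theta$ is a Cartan involution of $\mathfrak g$, with Cartan decomposition $\mathfrak g=\mathfrak k\oplus\mathfrak p$ into its $(+1)$- and $(-1)$-eigenspaces; $\mathfrak h\subseteq\mathfrak k$ is a Cartan subalgebra of $\mathfrak g$; and there is no $\operatorname{ad}(\mathfrak k)$-invariant $\kappa$-orthogonal complex structure on $\mathfrak p$. A root $\alpha$ of $\mathfrak g^{\mathbb C}$ with respect to $\mathfrak h^{\mathbb C}$ is called compact if its root space lies in $\mathfrak k^{\mathbb C}$, and noncompact if its root space lies in $\mathfrak p^{\mathbb C}$. Then for every compact root $\alpha$ there exist two noncompact roots $\beta,\gamma$ with $\beta+\gamma=\alpha$. Moreover $\mathfrak p$ and $[\mathfrak p,\mathfrak p]$ together span $\mathfrak g$; that is, for every subalgebra $\mathfrak z$ with $\mathfrak h\subseteq\mathfrak z\subseteq\mathfrak k$ they span $\mathfrak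 g/\mathfrak z$, which is the Lie-algebraic form of the Chow condition for the horizontal distribution of $G/Z\to G/K$ when $\mathfrak z$ is the Lie algebra of $Z$. -/

import Mathlib

open scoped TensorProduct

namespace HodgeType

section RealForm

variable {g : Type*} [LieRing g] [LieAlgebra ℝ g]

/-- A Cartan involution of a real Lie algebra: an involutive automorphism `θ` such that
`-κ(x, θ y)` is positive definite, where `κ` is the Killing form. -/
structure IsCartanInvolution (θ : g →ₗ⁅ℝ⁆ g) : Prop where
  involutive : ∀ x, θ (θ x) = x
  killingForm_neg : ∀ x, x ≠ 0 → killingForm ℝ g x (θ x) < 0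

/-- The subalgebra `𝔨` of the Cartan decomposition: the `+1`-eigenspace of `θ`. -/
def compactPart (θ : g →ₗ⁅ℝ⁆ g) : LieSubalgebra ℝ g where
  carrier := {x | θ x = x}
  add_mem' := by
    intro a b ha hb
    simp only [Set.mem_ofPred_eq] at ha hb ⊢
    rw [map_add, ha, hb]
  zero_mem' := map_zero θ
  smul_mem' := by
    intro c x hx
    simp only [Set.mem_ofPred_eq] at hx ⊢
    rw [map_smul, hx]
  lie_mem' := by
    intro x y hx hy
    change θ x = x at hx
    change θ y = y at hy
    change θ ⁅x, y⁆ = ⁅x, y⁆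
    rw [LieHom.map_lie, hx, hy]

/-- The subspace `𝔭` of the Cartan decomposition: the `-1`-eigenspace of `θ`. -/
def noncompactPart (θ : g →ₗ⁅ℝ⁆ g) : Submodule ℝ g where
  carrier := {x | θ x = -x}
  add_mem' := by
    intro a b ha hb
    simp only [Set.mem_ofPred_eq] at ha hb ⊢
    rw [map_add, ha, hb, neg_add]
  zero_mem' := by simp
  smul_mem' := by
    intro c x hx
    simp only [Set.mem_ofPred_eq] at hx ⊢
    rw [map_smul, hx, smul_neg]

variable (g) in
/-- A semisimple real Lie algebra is of compact type when its Killing form is negative definite. -/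
def IsOfCompactType : Prop :=
  ∀ x : g, x ≠ 0 → killingForm ℝ g x x < 0

/-- `𝔤` is of Hermitian type: the symmetric space `G/K` carries an invariant Hermitian structure.
At the base point, whose tangent space is `𝔭` with the Killing form as metric, this is an
`ad 𝔨`-invariant orthogonal complex structure `J` on `𝔭` (only the values of `J` on `𝔭` matter). -/
def IsHermitianType (θ : g →ₗ⁅ℝ⁆ g) : Prop :=
  ∃ J : g →ₗ[ℝ] g,
    (∀ y ∈ noncompactPart θ, J y ∈ noncompactPart θ) ∧
    (∀ y ∈ noncompactPart θ, J (J y) = -y) ∧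
    (∀ x ∈ compactPart θ, ∀ y ∈ noncompactPart θ, J ⁅x, y⁆ = ⁅x, J y⁆) ∧
    (∀ y ∈ noncompactPart θ, ∀ z ∈ noncompactPart θ,
      killingForm ℝ g (J y) (J z) = killingForm ℝ g y z)

end RealForm

/-- The weights of a Lie algebra `L` under the adjoint action of a nilpotent subalgebra `H`. -/
abbrev AdWeight {K L : Type*} [CommRing K] [LieRing L] [LieAlgebra K L] (H : LieSubalgebra K L)
    [LieRing.IsNilpotent H] : Type _ :=
  LieModule.Weight K H L

section Complexification

variable {g : Type*} [LieRing g] [LieAlgebra ℝ g]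

/-- The complexification `ℂ ⊗ 𝔰 ⊆ ℂ ⊗ 𝔤` of a subalgebra `𝔰 ⊆ 𝔤`. -/
noncomputable def complexify (s : LieSubalgebra ℝ g) : LieSubalgebra ℂ (ℂ ⊗[ℝ] g) :=
  { s.toSubmodule.baseChange ℂ with
    lie_mem' := by
      intro x y hx hy
      rw [Submodule.mem_carrier, SetLike.mem_coe] at hx hy ⊢
      rw [Submodule.baseChange_eq_span] at hx hy
      induction hx, hy using Submodule.span_induction₂ with
      | mem_mem x y hx hy =>
        obtain ⟨a, ha, rfl⟩ := hx
        obtain ⟨b, hb, rfl⟩ := hy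
        simp only [TensorProduct.mk_apply, LieAlgebra.ExtendScalars.bracket_tmul]
        exact Submodule.tmul_mem_baseChange_of_mem _ (s.lie_mem ha hb)
      | zero_left y hy => simp
      | zero_right x hx => simp
      | add_left x y z hx hy hz h1 h2 => rw [add_lie]; exact add_mem h1 h2
      | add_right x y z hx hy hz h1 h2 => rw [lie_add]; exact add_mem h1 h2
      | smul_left r x y hx hy h => rw [smul_lie]; exact Submodule.smul_mem _ _ h
      | smul_right r x y hx hy h => rw [lie_smul]; exact Submodule.smul_mem _ _ h }

theorem complexify_toSubmodule (s : LieSubalgebra ℝ g) :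
    (complexify s).toSubmodule = s.toSubmodule.baseChange ℂ := rfl

/-- The complexification of a nilpotent subalgebra is nilpotent, so that root spaces with respect
to the complexification of a Cartan subalgebra make sense. -/
instance complexify_isNilpotent (s : LieSubalgebra ℝ g) [LieRing.IsNilpotent s] :
    LieRing.IsNilpotent (complexify s) := by
  let f : ℂ ⊗[ℝ] s →ₗ⁅ℂ⁆ ℂ ⊗[ℝ] g :=
    { s.toSubmodule.subtype.baseChange ℂ with
      map_lie' := by
        intro x y
        exact (LieAlgebra.ExtendScalars.map (AlgHom.id ℝ ℂ) s.incl).map_lie x y }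
  have hf : f.range = complexify s := by
    rw [← LieSubalgebra.toSubmodule_inj, complexify_toSubmodule]
    rfl
  rw [← hf]
  exact f.isNilpotent_range

variable (θ : g →ₗ⁅ℝ⁆ g) (h : LieSubalgebra ℝ g) [LieRing.IsNilpotent h]

/-- A compact root: a nonzero weight of `𝔤^ℂ` under `𝔥^ℂ` whose root space lies in `𝔨^ℂ`. -/
def IsCompactRoot (α : AdWeight (complexify h)) : Prop :=
  α.IsNonZero ∧
    (LieAlgebra.rootSpace (complexify h) α).toSubmodule ≤
      (compactPart θ).toSubmodule.baseChange ℂ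

/-- A noncompact root: a nonzero weight of `𝔤^ℂ` under `𝔥^ℂ` whose root space lies in `𝔭^ℂ`. -/
def IsNoncompactRoot (α : AdWeight (complexify h)) : Prop :=
  α.IsNonZero ∧
    (LieAlgebra.rootSpace (complexify h) α).toSubmodule ≤
      (noncompactPart θ).baseChange ℂ

end Complexification

end HodgeType

/-!
Every compact root is a sum of two noncompact roots because `𝔭` generates `𝔤` in one bracket.

The subspace `𝔭 + [𝔭, 𝔭]` is an ideal of `𝔤`, by `[𝔨, 𝔭] ⊆ 𝔭` and `[𝔭, 𝔭] ⊆ 𝔨`, and it is nonzero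
since `𝔭 = 0` would make the Killing form negative definite. So simplicity gives
`𝔭 + [𝔭, 𝔭] = 𝔤` (`IsCartanInvolution.noncompactPart_sup_span_lie_eq_top`).

Over `ℂ`, the subalgebra `𝔥^ℂ` is again a Cartan subalgebra and the Killing form is again
nondegenerate, so the root spaces are lines. The involution fixes `𝔥^ℂ` pointwise, hence acts on
each of these lines by `1` or `-1`: every root is compact or noncompact, and `𝔭^ℂ` is the sum of the
noncompact root spaces (`IsCartanInvolution.baseChange_noncompactPart_le_iSup`). Consequently
`𝔤^ℂ = 𝔭^ℂ + [𝔭^ℂ, 𝔭^ℂ]` is spanned by the spaces `𝔤_β` and `[𝔤_β, 𝔤_γ] ⊆ 𝔤_{β + γ}` with `β, γ`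
noncompact, and the independence of the weight spaces forces every compact root to be such a
`β + γ` (`IsCompactRoot.exists_isNoncompactRoot_add_eq`).
-/

namespace HodgeType

/-! ### Cartan decompositions of real Lie algebras -/

section RealForm

variable {g : Type*} [LieRing g] [LieAlgebra ℝ g] {θ : g →ₗ⁅ℝ⁆ g}

theorem mem_compactPart {x : g} : x ∈ compactPart θ ↔ θ x = x := Iff.rfl

theorem mem_noncompactPart {x : g} : x ∈ noncompactPart θ ↔ θ x = -x := Iff.rfl

theorem lie_mem_noncompactPart {x y : g} (hx : x ∈ compactPart θ) (hy : y ∈ noncompactPart θ) :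
    ⁅x, y⁆ ∈ noncompactPart θ := by
  rw [mem_compactPart] at hx
  rw [mem_noncompactPart] at hy ⊢
  rw [LieHom.map_lie, hx, hy, lie_neg]

theorem lie_mem_compactPart {x y : g} (hx : x ∈ noncompactPart θ) (hy : y ∈ noncompactPart θ) :
    ⁅x, y⁆ ∈ compactPart θ := by
  rw [mem_noncompactPart] at hx hy
  rw [mem_compactPart, LieHom.map_lie, hx, hy, lie_neg, neg_lie, neg_neg]

namespace IsCartanInvolution

theorem add_apply_mem_compactPart (hθ : IsCartanInvolution θ) (x : g) :
    x + θ x ∈ compactPart θ := by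
  rw [mem_compactPart, map_add, hθ.involutive, add_comm]

theorem sub_apply_mem_noncompactPart (hθ : IsCartanInvolution θ) (x : g) :
    x - θ x ∈ noncompactPart θ := by
  rw [mem_noncompactPart, map_sub, hθ.involutive, neg_sub]

theorem exists_add_eq (hθ : IsCartanInvolution θ) (x : g) :
    ∃ k ∈ compactPart θ, ∃ p ∈ noncompactPart θ, k + p = x := by
  refine ⟨(2⁻¹ : ℝ) • (x + θ x), (compactPart θ).smul_mem _ (hθ.add_apply_mem_compactPart x),
    (2⁻¹ : ℝ) • (x - θ x), Submodule.smul_mem _ _ (hθ.sub_apply_mem_noncompactPart x), ?_⟩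
  module

/-- If `𝔤` is simple and not of compact type, then `𝔭 + [𝔭, 𝔭]` is all of `𝔤`: it is an ideal,
and it is nonzero because `𝔭 = 0` would make `θ` the identity and the Killing form negative
definite. -/
theorem noncompactPart_sup_span_lie_eq_top [LieAlgebra.IsSimple ℝ g]
    (hθ : IsCartanInvolution θ) (hnc : ¬ IsOfCompactType g) :
    noncompactPart θ ⊔ Submodule.span ℝ {z | ∃ x ∈ noncompactPart θ,
      ∃ y ∈ noncompactPart θ, z = ⁅x, y⁆} = ⊤ := by
  set D := Submodule.span ℝ {z | ∃ x ∈ noncompactPart θ, ∃ y ∈ noncompactPart θ, z = ⁅x, y⁆}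
    with hD
  have hDk : D ≤ (compactPart θ).toSubmodule := by
    rw [hD, Submodule.span_le]
    rintro _ ⟨x, hx, y, hy, rfl⟩
    exact lie_mem_compactPart hx hy
  have hkD : ∀ k ∈ compactPart θ, ∀ d ∈ D, ⁅k, d⁆ ∈ D := by
    intro k hk d hd
    induction hd using Submodule.span_induction with
    | mem d hd =>
      obtain ⟨x, hx, y, hy, rfl⟩ := hd
      rw [leibniz_lie]
      exact add_mem (Submodule.subset_span ⟨_, lie_mem_noncompactPart hk hx, _, hy, rfl⟩)
        (Submodule.subset_span ⟨_, hx, _, lie_mem_noncompactPart hk hy, rfl⟩)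
    | zero => simp
    | add a b _ _ ha hb => rw [lie_add]; exact add_mem ha hb
    | smul r a _ ha => rw [lie_smul]; exact D.smul_mem r ha
  let I : LieIdeal ℝ g :=
    { noncompactPart θ ⊔ D with
      lie_mem := by
        intro x m hm
        obtain ⟨k, hk, p, hp, rfl⟩ := hθ.exists_add_eq x
        obtain ⟨q, hq, d, hd, rfl⟩ := Submodule.mem_sup.mp hm
        have hdp : ⁅p, d⁆ ∈ noncompactPart θ := by
          rw [← lie_skew]
          exact neg_mem (lie_mem_noncompactPart (hDk hd) hp)
        have hsum : ⁅k + p, q + d⁆ = (⁅k, q⁆ + ⁅p, d⁆) + (⁅p, q⁆ + ⁅k, d⁆) := by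
          rw [add_lie, lie_add, lie_add]; abel
        rw [hsum]
        exact Submodule.add_mem_sup (add_mem (lie_mem_noncompactPart hk hq) hdp)
          (add_mem (Submodule.subset_span ⟨p, hp, q, hq, rfl⟩) (hkD k hk d hd)) }
  have hI : I.toSubmodule = noncompactPart θ ⊔ D := rfl
  rcases LieAlgebra.IsSimple.eq_bot_or_eq_top (R := ℝ) I with h | h
  · refine absurd (fun x hx => ?_) hnc
    have hmem : x - θ x ∈ I.toSubmodule :=
      hI ▸ Submodule.mem_sup_left (hθ.sub_apply_mem_noncompactPart x)
    rw [h] at hmem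
    have hfix : θ x = x := (sub_eq_zero.mp (by simpa using hmem)).symm
    simpa [hfix] using hθ.killingForm_neg x hx
  · rw [← hI, h]; rfl

end IsCartanInvolution

end RealForm

/-! ### Real and imaginary parts in the complexification -/

section Complexification

variable {g : Type*} [LieRing g] [LieAlgebra ℝ g]

variable (g) in
/-- The real part `a ⊗ x ↦ (re a) • x` of the complexification, as a real-linear map. -/
noncomputable def rePart : ℂ ⊗[ℝ] g →ₗ[ℝ] g :=
  (TensorProduct.lid ℝ g).toLinearMap ∘ₗ Complex.reLm.rTensor g

variable (g) in
/-- The imaginary part `a ⊗ x ↦ (im a) • x` of the complexification, as a real-linear map. -/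
noncomputable def imPart : ℂ ⊗[ℝ] g →ₗ[ℝ] g :=
  (TensorProduct.lid ℝ g).toLinearMap ∘ₗ Complex.imLm.rTensor g

@[simp]
theorem rePart_tmul (a : ℂ) (x : g) : rePart g (a ⊗ₜ x) = a.re • x := by simp [rePart]

@[simp]
theorem imPart_tmul (a : ℂ) (x : g) : imPart g (a ⊗ₜ x) = a.im • x := by simp [imPart]

theorem tmul_rePart_add_tmul_imPart (z : ℂ ⊗[ℝ] g) :
    (1 : ℂ) ⊗ₜ[ℝ] rePart g z + Complex.I ⊗ₜ[ℝ] imPart g z = z := by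
  induction z using TensorProduct.induction_on with
  | zero => simp
  | tmul a x =>
    rw [rePart_tmul, imPart_tmul, ← TensorProduct.smul_tmul, ← TensorProduct.smul_tmul,
      ← TensorProduct.add_tmul]
    congr 1
    apply Complex.ext <;> simp
  | add z w hz hw =>
    rw [map_add, map_add, TensorProduct.tmul_add, TensorProduct.tmul_add]
    nth_rewrite 3 [← hz]
    nth_rewrite 3 [← hw]
    abel

theorem rePart_lie_one_tmul (z : ℂ ⊗[ℝ] g) (x : g) :
    rePart g ⁅z, (1 : ℂ) ⊗ₜ[ℝ] x⁆ = ⁅rePart g z, x⁆ := by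
  induction z using TensorProduct.induction_on with
  | zero => simp
  | tmul a y => simp
  | add z w hz hw => rw [add_lie, map_add, map_add, add_lie, hz, hw]

theorem imPart_lie_one_tmul (z : ℂ ⊗[ℝ] g) (x : g) :
    imPart g ⁅z, (1 : ℂ) ⊗ₜ[ℝ] x⁆ = ⁅imPart g z, x⁆ := by
  induction z using TensorProduct.induction_on with
  | zero => simp
  | tmul a y => simp
  | add z w hz hw => rw [add_lie, map_add, map_add, add_lie, hz, hw]

theorem mem_baseChange_iff_rePart_imPart (s : Submodule ℝ g) (z : ℂ ⊗[ℝ] g) :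
    z ∈ s.baseChange ℂ ↔ rePart g z ∈ s ∧ imPart g z ∈ s := by
  constructor
  · intro hz
    rw [Submodule.baseChange_eq_span] at hz
    induction hz using Submodule.span_induction with
    | mem z hz =>
      obtain ⟨x, hx, rfl⟩ := hz
      simpa using hx
    | zero => simp
    | add z w _ _ hz hw =>
      rw [map_add, map_add]
      exact ⟨add_mem hz.1 hw.1, add_mem hz.2 hw.2⟩
    | smul c z _ hz =>
      rw [← tmul_rePart_add_tmul_imPart z, smul_add, TensorProduct.smul_tmul',
        TensorProduct.smul_tmul', map_add, map_add]
      simp only [rePart_tmul, imPart_tmul]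
      exact ⟨add_mem (s.smul_mem _ hz.1) (s.smul_mem _ hz.2),
        add_mem (s.smul_mem _ hz.1) (s.smul_mem _ hz.2)⟩
  · rintro ⟨hr, hi⟩
    rw [← tmul_rePart_add_tmul_imPart z]
    exact add_mem (Submodule.tmul_mem_baseChange_of_mem _ hr)
      (Submodule.tmul_mem_baseChange_of_mem _ hi)

/-! ### Cartan subalgebras and the Killing form under complexification -/

/-- The real and imaginary parts of an element normalizing `𝔥^ℂ` normalize `𝔥`, so the
complexification of a Cartan subalgebra is self-normalizing. -/
instance complexify_isCartanSubalgebra (h : LieSubalgebra ℝ g) [h.IsCartanSubalgebra] :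
    (complexify h).IsCartanSubalgebra where
  nilpotent := inferInstance
  self_normalizing := by
    refine le_antisymm (fun z hz => ?_) (complexify h).le_normalizer
    have key : ∀ a ∈ h, ⁅z, (1 : ℂ) ⊗ₜ[ℝ] a⁆ ∈ h.toSubmodule.baseChange ℂ := fun a ha =>
      (LieSubalgebra.mem_normalizer_iff _ _).mp hz _
        (Submodule.tmul_mem_baseChange_of_mem (p := h.toSubmodule) 1 ha)
    simp only [mem_baseChange_iff_rePart_imPart, rePart_lie_one_tmul, imPart_lie_one_tmul] at key
    refine (mem_baseChange_iff_rePart_imPart h.toSubmodule z).mpr ⟨?_, ?_⟩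
    · change rePart g z ∈ h
      rw [← LieSubalgebra.IsCartanSubalgebra.self_normalizing (H := h),
        LieSubalgebra.mem_normalizer_iff]
      exact fun a ha => (key a ha).1
    · change imPart g z ∈ h
      rw [← LieSubalgebra.IsCartanSubalgebra.self_normalizing (H := h),
        LieSubalgebra.mem_normalizer_iff]
      exact fun a ha => (key a ha).2

variable {θ : g →ₗ⁅ℝ⁆ g}

/-- The Killing form of `𝔤^ℂ` is the complexified Killing form of `𝔤`, and the latter is
nondegenerate because `κ(x, θ x) < 0` for `x ≠ 0`. -/
theorem IsCartanInvolution.isKilling_complexification [FiniteDimensional ℝ g]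
    (hθ : IsCartanInvolution θ) :
    LieAlgebra.IsKilling ℂ (ℂ ⊗[ℝ] g) where
  killingCompl_top_eq_bot := by
    have hker : ∀ x : g, (∀ w, killingForm ℝ g x w = 0) → x = 0 := by
      intro x hx
      by_contra hne
      exact (hθ.killingForm_neg x hne).ne (hx _)
    rw [LieSubmodule.eq_bot_iff]
    intro z hz
    rw [LieIdeal.mem_killingCompl] at hz
    have key : ∀ w : g, ((killingForm ℝ g (rePart g z) w : ℝ) : ℂ) +
        (killingForm ℝ g (imPart g z) w : ℝ) * Complex.I = 0 := by
      intro w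
      have h := hz ((1 : ℂ) ⊗ₜ[ℝ] w) trivial
      rw [LieModule.traceForm_comm, ← tmul_rePart_add_tmul_imPart z,
        LieModule.traceForm_baseChange] at h
      simpa [mul_comm] using h
    have hre : rePart g z = 0 := hker _ fun w => by simpa using congrArg Complex.re (key w)
    have him : imPart g z = 0 := hker _ fun w => by simpa using congrArg Complex.im (key w)
    rw [← tmul_rePart_add_tmul_imPart z, hre, him]
    simp

/-! ### The involution of the complexification -/

/-- The complex-linear extension of `θ` to `𝔤^ℂ`. -/
noncomputable def complexInvolution (θ : g →ₗ⁅ℝ⁆ g) : ℂ ⊗[ℝ] g →ₗ[ℂ] ℂ ⊗[ℝ] g :=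
  (θ : g →ₗ[ℝ] g).baseChange ℂ

@[simp]
theorem complexInvolution_tmul (a : ℂ) (x : g) :
    complexInvolution θ (a ⊗ₜ x) = a ⊗ₜ θ x := rfl

theorem complexInvolution_lie (x y : ℂ ⊗[ℝ] g) :
    complexInvolution θ ⁅x, y⁆ = ⁅complexInvolution θ x, complexInvolution θ y⁆ :=
  (LieAlgebra.ExtendScalars.map (AlgHom.id ℝ ℂ) θ).map_lie x y

theorem rePart_complexInvolution (z : ℂ ⊗[ℝ] g) :
    rePart g (complexInvolution θ z) = θ (rePart g z) := by
  rw [← tmul_rePart_add_tmul_imPart z]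
  simp

theorem imPart_complexInvolution (z : ℂ ⊗[ℝ] g) :
    imPart g (complexInvolution θ z) = θ (imPart g z) := by
  rw [← tmul_rePart_add_tmul_imPart z]
  simp

theorem eq_iff_rePart_imPart {z w : ℂ ⊗[ℝ] g} :
    z = w ↔ rePart g z = rePart g w ∧ imPart g z = imPart g w := by
  refine ⟨fun h => h ▸ ⟨rfl, rfl⟩, fun h => ?_⟩
  rw [← tmul_rePart_add_tmul_imPart z, h.1, h.2, tmul_rePart_add_tmul_imPart]

theorem IsCartanInvolution.complexInvolution_involutive (hθ : IsCartanInvolution θ)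
    (z : ℂ ⊗[ℝ] g) : complexInvolution θ (complexInvolution θ z) = z := by
  simp [eq_iff_rePart_imPart, rePart_complexInvolution, imPart_complexInvolution, hθ.involutive]

theorem mem_baseChange_compactPart {z : ℂ ⊗[ℝ] g} :
    z ∈ (compactPart θ).toSubmodule.baseChange ℂ ↔ complexInvolution θ z = z := by
  rw [mem_baseChange_iff_rePart_imPart, eq_iff_rePart_imPart, rePart_complexInvolution,
    imPart_complexInvolution]
  rfl

theorem mem_baseChange_noncompactPart {z : ℂ ⊗[ℝ] g} :
    z ∈ (noncompactPart θ).baseChange ℂ ↔ complexInvolution θ z = -z := by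
  rw [mem_baseChange_iff_rePart_imPart, eq_iff_rePart_imPart, rePart_complexInvolution,
    imPart_complexInvolution, map_neg, map_neg]
  rfl

theorem disjoint_baseChange_compactPart_noncompactPart :
    Disjoint ((compactPart θ).toSubmodule.baseChange ℂ) ((noncompactPart θ).baseChange ℂ) := by
  rw [Submodule.disjoint_def]
  intro z hk hp
  rw [mem_baseChange_compactPart] at hk
  rw [mem_baseChange_noncompactPart, hk] at hp
  have h2 : (2 : ℂ) • z = 0 := by rw [two_smul]; nth_rewrite 1 [hp]; exact neg_add_cancel z
  exact (smul_eq_zero.mp h2).resolve_left two_ne_zero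

/-! ### Compact and noncompact roots -/

section RootSpaces

variable {h : LieSubalgebra ℝ g}

theorem complexInvolution_eq_self_of_mem_complexify (hcompact : h ≤ compactPart θ)
    {x : ℂ ⊗[ℝ] g} (hx : x ∈ complexify h) : complexInvolution θ x = x :=
  by
  have hx' := (mem_baseChange_iff_rePart_imPart h.toSubmodule x).mp hx
  exact mem_baseChange_compactPart.mp
    ((mem_baseChange_iff_rePart_imPart _ x).mpr ⟨hcompact hx'.1, hcompact hx'.2⟩)

/-- Because `𝔥 ⊆ 𝔨`, the involution commutes with the adjoint action of `𝔥^ℂ` and hence preserves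
each of its root spaces. -/
theorem complexInvolution_mem_rootSpace [LieRing.IsNilpotent h] (hcompact : h ≤ compactPart θ)
    (χ : complexify h → ℂ) {z : ℂ ⊗[ℝ] g} (hz : z ∈ LieAlgebra.rootSpace (complexify h) χ) :
    complexInvolution θ z ∈ LieAlgebra.rootSpace (complexify h) χ := by
  let f : (ℂ ⊗[ℝ] g) →ₗ⁅ℂ, complexify h⁆ (ℂ ⊗[ℝ] g) :=
    { complexInvolution θ with
      map_lie' := by
        intro x m
        change complexInvolution θ ⁅(x : ℂ ⊗[ℝ] g), m⁆ = ⁅(x : ℂ ⊗[ℝ] g), complexInvolution θ m⁆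
        rw [complexInvolution_lie, complexInvolution_eq_self_of_mem_complexify hcompact x.2] }
  exact LieModule.map_genWeightSpace_le f (LieSubmodule.mem_map_of_mem (f := f) hz)

variable [FiniteDimensional ℝ g] [h.IsCartanSubalgebra]

/-- Every root is compact or noncompact: its root space is a line preserved by an involution. -/
theorem IsCartanInvolution.isCompactRoot_or_isNoncompactRoot (hθ : IsCartanInvolution θ)
    (hcompact : h ≤ compactPart θ) (β : AdWeight (complexify h)) (hβ : β.IsNonZero) :
    IsCompactRoot θ h β ∨ IsNoncompactRoot θ h β := by
  have := hθ.isKilling_complexification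
  obtain ⟨⟨v, hv⟩, hv0, hspan⟩ := finrank_eq_one_iff'.mp
    (LieAlgebra.IsKilling.finrank_rootSpace_eq_one β hβ)
  replace hv0 : v ≠ 0 := fun h0 => hv0 (Subtype.ext h0)
  replace hspan : ∀ w ∈ LieAlgebra.rootSpace (complexify h) β, ∃ c : ℂ, c • v = w := by
    intro w hw
    obtain ⟨c, hc⟩ := hspan ⟨w, hw⟩
    exact ⟨c, congrArg Subtype.val hc⟩
  obtain ⟨c, hc⟩ := hspan _ (complexInvolution_mem_rootSpace hcompact β hv)
  have hcc : (c * c) • v = (1 : ℂ) • v := by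
    rw [mul_smul, hc, ← map_smul, hc, hθ.complexInvolution_involutive, one_smul]
  rcases mul_self_eq_one_iff.mp (smul_left_injective ℂ hv0 hcc) with rfl | rfl
  · refine Or.inl ⟨hβ, fun w hw => ?_⟩
    obtain ⟨d, rfl⟩ := hspan w hw
    rw [mem_baseChange_compactPart, map_smul, ← hc, one_smul]
  · refine Or.inr ⟨hβ, fun w hw => ?_⟩
    obtain ⟨d, rfl⟩ := hspan w hw
    rw [mem_baseChange_noncompactPart, map_smul, ← hc, neg_one_smul, smul_neg]

/-- `𝔭^ℂ` is the sum of the noncompact root spaces: apply the projection `z ↦ (z - θ z) / 2` onto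
`𝔭^ℂ` to the root space decomposition of `𝔤^ℂ`; it kills `𝔥^ℂ` and the compact root spaces. -/
theorem IsCartanInvolution.baseChange_noncompactPart_le_iSup (hθ : IsCartanInvolution θ)
    (hcompact : h ≤ compactPart θ) :
    (noncompactPart θ).baseChange ℂ ≤
      ⨆ β : {β : AdWeight (complexify h) // IsNoncompactRoot θ h β},
        (LieAlgebra.rootSpace (complexify h) β.1).toSubmodule := by
  have := hθ.isKilling_complexification
  set S := ⨆ β : {β : AdWeight (complexify h) // IsNoncompactRoot θ h β},
    (LieAlgebra.rootSpace (complexify h) β.1).toSubmodule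
  have key : ∀ z : ℂ ⊗[ℝ] g, z - complexInvolution θ z ∈ S := by
    intro z
    have hz : z ∈ ⨆ β : AdWeight (complexify h), LieAlgebra.rootSpace (complexify h) β := by
      rw [LieModule.iSup_genWeightSpace_eq_top' ℂ (complexify h) (ℂ ⊗[ℝ] g)]
      trivial
    induction hz using LieSubmodule.iSup_induction' with
    | mem β z hz =>
      by_cases hβ : β.IsZero
      · have hzh : z ∈ complexify h := by
          rw [hβ.eq, LieAlgebra.rootSpace_zero_eq] at hz
          exact hz
        rw [complexInvolution_eq_self_of_mem_complexify hcompact hzh, sub_self]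
        exact zero_mem _
      · rcases hθ.isCompactRoot_or_isNoncompactRoot hcompact β hβ with hk | hp
        · rw [mem_baseChange_compactPart.mp (hk.2 hz), sub_self]
          exact zero_mem _
        · exact Submodule.mem_iSup_of_mem ⟨β, hp⟩
            (sub_mem hz (complexInvolution_mem_rootSpace hcompact β hz))
    | zero => simp
    | add z w _ _ hz hw =>
      rw [map_add, add_sub_add_comm]
      exact add_mem hz hw
  intro z hz
  have h2 := S.smul_mem (2⁻¹ : ℂ) (key z)
  rw [mem_baseChange_noncompactPart.mp hz] at h2
  convert h2 using 1
  module

/-- If `𝔭 + [𝔭, 𝔭] = 𝔤`, every compact root is a sum of two noncompact roots. Otherwise `𝔭^ℂ` and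
`[𝔭^ℂ, 𝔭^ℂ]`, which are spanned by noncompact root spaces and their brackets, would lie in the sum
of the generalized weight spaces other than the `α` one, a proper subspace. -/
theorem IsCompactRoot.exists_isNoncompactRoot_add_eq (hθ : IsCartanInvolution θ)
    (hcompact : h ≤ compactPart θ)
    (htop : noncompactPart θ ⊔ Submodule.span ℝ {z | ∃ x ∈ noncompactPart θ,
      ∃ y ∈ noncompactPart θ, z = ⁅x, y⁆} = ⊤)
    {α : AdWeight (complexify h)} (hα : IsCompactRoot θ h α) :
    ∃ β γ : AdWeight (complexify h), IsNoncompactRoot θ h β ∧ IsNoncompactRoot θ h γ ∧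
      ∀ x, β x + γ x = α x := by
  by_contra! hcon
  set T : LieSubmodule ℂ (complexify h) (ℂ ⊗[ℝ] g) :=
    ⨆ (χ : complexify h → ℂ) (_ : χ ≠ α), LieAlgebra.rootSpace (complexify h) χ with hT
  have hle : ∀ {χ : complexify h → ℂ}, χ ≠ α →
      LieAlgebra.rootSpace (complexify h) χ ≤ T := fun {χ} hχ =>
    le_iSup₂ (f := fun (χ : complexify h → ℂ) (_ : χ ≠ α) =>
      LieAlgebra.rootSpace (complexify h) χ) χ hχ
  set S := ⨆ β : {β : AdWeight (complexify h) // IsNoncompactRoot θ h β},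
    (LieAlgebra.rootSpace (complexify h) β.1).toSubmodule
  have hpS : (noncompactPart θ).baseChange ℂ ≤ S := hθ.baseChange_noncompactPart_le_iSup hcompact
  have hST : S ≤ T.toSubmodule := by
    refine iSup_le fun β => hle fun hβα => ?_
    have hβ := β.2.2
    rw [hβα] at hβ
    refine α.genWeightSpace_ne_bot _ (LieSubmodule.toSubmodule_injective ?_)
    exact disjoint_self.mp (disjoint_baseChange_compactPart_noncompactPart.mono hα.2 hβ)
  have hlie : ∀ x ∈ S, ∀ y ∈ S, ⁅x, y⁆ ∈ T.toSubmodule := by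
    intro x hx y hy
    induction hx using Submodule.iSup_induction' with
    | mem β x hx =>
      induction hy using Submodule.iSup_induction' with
      | mem γ y hy =>
        refine hle (fun hsum => ?_)
          (LieAlgebra.lie_mem_genWeightSpace_of_mem_genWeightSpace hx hy)
        obtain ⟨t, ht⟩ := hcon β γ β.2 γ.2
        exact ht (congrFun hsum t)
      | zero => rw [lie_zero x]; exact zero_mem _
      | add y z _ _ hy hz => rw [lie_add x y z]; exact add_mem hy hz
    | zero => simp
    | add x z _ _ hx hz => rw [add_lie]; exact add_mem hx hz
  have hone : ∀ x : g, (1 : ℂ) ⊗ₜ[ℝ] x ∈ T.toSubmodule := by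
    have hp : ∀ x ∈ noncompactPart θ, (1 : ℂ) ⊗ₜ[ℝ] x ∈ S := fun x hx =>
      hpS (Submodule.tmul_mem_baseChange_of_mem _ hx)
    have hcomap : (⊤ : Submodule ℝ g) ≤ (T.toSubmodule.restrictScalars ℝ).comap
        (TensorProduct.mk ℝ ℂ g 1) := by
      rw [← htop, sup_le_iff, Submodule.span_le]
      refine ⟨fun x hx => hST (hp x hx), ?_⟩
      rintro _ ⟨x, hx, y, hy, rfl⟩
      have hxy := hlie _ (hp x hx) _ (hp y hy)
      rwa [LieAlgebra.ExtendScalars.bracket_tmul, one_mul] at hxy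
    exact fun x => hcomap trivial
  have hTtop : T = ⊤ := by
    refine eq_top_iff.mpr fun z _ => ?_
    have hz : Complex.I • ((1 : ℂ) ⊗ₜ[ℝ] imPart g z) ∈ T.toSubmodule :=
      T.toSubmodule.smul_mem _ (hone _)
    rw [TensorProduct.smul_tmul', smul_eq_mul, mul_one] at hz
    rw [← tmul_rePart_add_tmul_imPart z]
    exact add_mem (hone _) hz
  have hdisj := LieModule.iSupIndep_genWeightSpace ℂ (complexify h) (ℂ ⊗[ℝ] g)
    (α : complexify h → ℂ)
  rw [← hT, hTtop, disjoint_top] at hdisj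
  exact α.genWeightSpace_ne_bot _ hdisj

end RootSpaces

end Complexification

end HodgeType

theorem proposition2 {g : Type*} [LieRing g] [LieAlgebra ℝ g] [FiniteDimensional ℝ g]
    (hsimple : LieAlgebra.IsSimple ℝ g)
    (hnoncompact : ¬ HodgeType.IsOfCompactType g)
    (θ : g →ₗ⁅ℝ⁆ g) (hθ : HodgeType.IsCartanInvolution θ)
    (hnotHermitian : ¬ HodgeType.IsHermitianType θ)
    (h : LieSubalgebra ℝ g) [h.IsCartanSubalgebra] (hcompact : h ≤ HodgeType.compactPart θ) :
    (∀ α : HodgeType.AdWeight (HodgeType.complexify h),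
      HodgeType.IsCompactRoot θ h α →
        ∃ β γ : HodgeType.AdWeight (HodgeType.complexify h),
          HodgeType.IsNoncompactRoot θ h β ∧ HodgeType.IsNoncompactRoot θ h γ ∧
            ∀ x, β x + γ x = α x) ∧
    HodgeType.noncompactPart θ ⊔
      Submodule.span ℝ {z | ∃ x ∈ HodgeType.noncompactPart θ,
        ∃ y ∈ HodgeType.noncompactPart θ, z = ⁅x, y⁆} = ⊤ := by
  have htop := hθ.noncompactPart_sup_span_lie_eq_top hnoncompact
  exact ⟨fun _ hα => hα.exists_isNoncompactRoot_add_eq hθ hcompact htop, htop⟩
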